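/- For $n\ge 1$ let $\mathrm{Conj}_n$ be the class of general conjunctions, i.e. of the functions $f:\{0,1\}^n\to\{0,1\}$ of the form $f(z)=\bigwedge_{i\in S} z_i\wedge\bigwedge_{i\in S'}\overline{z_i}$ with $S,S'\subseteq[n]$. For a probability distribution $\mathcal D$ on $\{0,1\}^n$, say that $f$ is $\epsilon$-far from $\mathrm{Conj}_n$ with respect to $\mathcal D$ if $\min_{g\in \mathrm{Conj}_n}\Pr_{z\sim\mathcal D}[f(z)\ne g(z)]\ge\epsilon$. Consider probabilistic adaptive algorithms (in the query-complexity model, i.e. randomized decision trees) that have access to an unknown function $f:\{0,1\}^n\to\{0,1\}$ and an unknown distribution $\mathcal D$ on $\{0,1\}^n$ through a black-box oracle, which returns $f(z)$ on a query $z$, and a sampling oracle, which returns $(z,f(z))$ with $z$ drawn independently from $\mathcal D$ each time. There are an absolute constant $K$ and, for every $n\ge1$, such an algorithm $T$, with the distance parameter $\epsilon>0$ as input, such that for every $\epsilon>0$, every $f$ and every $\mathcal D$: 1. if $f\in\mathrm{Conj}_n$, then $T$ accepts with probability $1$; 2. if $f$ is $\epsilon$-far from $\mathrm{Conj}_n$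 with respect to $\mathcal D$, then $T$ rejects with probability at least $2/3$; and, whenever $0<\epsilon\le1$, $T$ always makes at most $K\cdot(n^{1/3}/\epsilon^5)\cdot\log^7(n/\epsilon)$ queries, counting the calls to both oracles. (For $\epsilon>1$ no function is $\epsilon$-far and there is nothing to test.) -/

import Mathlib

namespace DistFree

/-- Strings in `{0,1}^n`, with `true` for `1` and `false` for `0`. -/
abbrev Str (n : ℕ) : Type := Fin n → Bool

/-- Boolean functions `f : {0,1}^n → {0,1}`. -/
abbrev BoolFun (n : ℕ) : Type := Str n → Bool

/-- `dist_D(f, g) = Pr_{z ∼ D} [f z ≠ g z]`. -/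
noncomputable def dist {n : ℕ} (D : PMF (Str n)) (f g : BoolFun n) : ℝ :=
  ∑ z : Str n, if f z ≠ g z then (D z).toReal else 0

/-- `dist_D(f, C)`, the minimum of `dist_D(f, g)` over `g` in the (finite, nonempty) class `C`. -/
noncomputable def distClass {n : ℕ} (D : PMF (Str n)) (f : BoolFun n) (C : Set (BoolFun n)) : ℝ :=
  ⨅ g : C, dist D f g

/-- `f` is `ε`-far from `C` with respect to `D`. -/
def IsFar {n : ℕ} (ε : ℝ) (D : PMF (Str n)) (f : BoolFun n) (C : Set (BoolFun n)) : Prop :=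
  ε ≤ distClass D f C

/-- The class of general conjunctions: `f` is the conjunction of the variables `z i`, `i ∈ S`, and
of the negated variables `z i`, `i ∈ S'`. The sets may be empty and may overlap. -/
def conj (n : ℕ) : Set (BoolFun n) :=
  {f | ∃ S S' : Finset (Fin n), ∀ z : Str n,
    f z = true ↔ (∀ i ∈ S, z i = true) ∧ (∀ i ∈ S', z i = false)}

/-- Probabilistic adaptive oracle algorithms on functions of `n` variables, as decision trees.
At each step the algorithm halts with a verdict (`true` is "accept", `false` is "reject"), or
draws a uniform element of a finite nonempty set, or queries the black-box oracle at a string, or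
calls the sampling oracle and receives a labelled string; it continues depending on the outcome. -/
inductive OracleAlg (n : ℕ) : Type
  | halt (verdict : Bool) : OracleAlg n
  | toss (k : ℕ) (next : Fin (k + 1) → OracleAlg n) : OracleAlg n
  | query (z : Str n) (next : Bool → OracleAlg n) : OracleAlg n
  | sample (next : Str n → Bool → OracleAlg n) : OracleAlg n

namespace OracleAlg

/-- The distribution of the verdict when the algorithm is run on the pair `(f, D)`: the black-box
oracle answers a query `z` by `f z`, and the sampling oracle returns `(z, f z)` with `z` drawn
from `D`, independently each time. -/
noncomputable def run {n : ℕ} (f : BoolFun n) (D : PMF (Str n)) : OracleAlg n → PMF Bool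
  | halt verdict => PMF.pure verdict
  | toss k next => (PMF.uniformOfFintype (Fin (k + 1))).bind fun i => run f D (next i)
  | query z next => run f D (next (f z))
  | sample next => D.bind fun z => run f D (next z (f z))

/-- The maximal number of oracle calls (to the black-box oracle and to the sampling oracle
together) on a path of the decision tree. -/
def numQueries {n : ℕ} : OracleAlg n → ℕ
  | halt _ => 0
  | toss _ next => Finset.univ.sup fun i => numQueries (next i)
  | query _ next => 1 + Finset.univ.sup fun b => numQueries (next b)
  | sample next => 1 + Finset.univ.sup fun z => Finset.univ.sup fun b => numQueries (next z b)

end OracleAlg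

/-- `T`, which takes the distance parameter `ε` as input, is a distribution-free testing algorithm
for the class `C`. -/
def IsTester {n : ℕ} (C : Set (BoolFun n)) (T : ℝ → OracleAlg n) : Prop :=
  ∀ ε : ℝ, 0 < ε → ∀ (f : BoolFun n) (D : PMF (Str n)),
    (f ∈ C → 2 / 3 ≤ ((T ε).run f D true).toReal) ∧
    (IsFar ε D f C → 2 / 3 ≤ ((T ε).run f D false).toReal)

/-- `T` is one-sided: it always accepts the members of `C`. -/
def IsOneSided {n : ℕ} (C : Set (BoolFun n)) (T : ℝ → OracleAlg n) : Prop :=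
  ∀ ε : ℝ, 0 < ε → ∀ (f : BoolFun n) (D : PMF (Str n)),
    f ∈ C → (T ε).run f D true = 1

end DistFree

/-! Fix a positive string `r`. A conjunction with `f r = true` says "agree with `r` on `U`". Hence
positive strings differ from `r` only outside `U`, and binary search between `r` and a negative
string ends at a witness in `U`. A round draws `r`, about `n ^ (1/3)` samples and a random colouring
of the coordinates with about `n ^ (2/3) / ε` colours. Let the union be that of the difference sets
of the positive samples. The round checks that flipping a tested colour class of the union keeps `f`
true. For each negative sample it also checks that the witness lies outside the union and that
adding it to colour class `0` of the union makes `f` false. Conjunctions pass every check.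

For far `f`, say that a coordinate clashes if it would fail the negative check against the other
samples, and let `S` be the coordinates whose average clash probability is at most 1/10. If
rejection is rare, witnesses rarely fall outside `S`. As `f` is far from "agree with `r` on `S`",
positive samples then often differ from `r` inside `S`. A coordinate of `S` contributed by a single
sample usually turns `f` false when it joins a random colour class of the union of the others. If it
is also the only new element of its colour, the check of that colour, when tested, sees exactly this
set and rejects.

The expected number of such isolated coordinates is bounded below, because the coordinates private
to one sample are disjoint over the samples and cost at most `n` altogether. A second-moment
(Bonferroni) bound turns the expectation into a rejection probability of order `ε ^ 2`. A further
factor `ε` comes from `r` being positive, so order `1 / ε ^ 3` rounds suffice. The core is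
`rejects_lower`, fed by `far_support`; completeness is `not_roundRejects_of_mem_conj`. -/

namespace DistFree

/-! ### Expectations under product distributions -/

/-- The expectation of `F` under the product of copies of the distribution with weights `w`. -/
noncomputable def prodExp {ι α : Type*} [Fintype ι] [DecidableEq ι] [Fintype α] (w : α → ℝ)
    (F : (ι → α) → ℝ) : ℝ :=
  ∑ z : ι → α, (∏ j, w (z j)) * F z

section prodExp

variable {ι α : Type*} [Fintype ι] [DecidableEq ι] [Fintype α] {w : α → ℝ}

theorem prodExp_mono (hw : ∀ a, 0 ≤ w a) {F G : (ι → α) → ℝ} (h : ∀ z, F z ≤ G z) :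
    prodExp w F ≤ prodExp w G :=
  Finset.sum_le_sum fun z _ =>
    mul_le_mul_of_nonneg_left (h z) (Finset.prod_nonneg fun _ _ => hw _)

theorem prodExp_const (hs : ∑ a, w a = 1) (r : ℝ) :
    prodExp w (fun _ : ι → α => r) = r := by
  classical
  unfold prodExp
  rw [← Finset.sum_mul, ← Fintype.prod_sum (fun (_ : ι) a => w a)]
  simp [hs]

theorem prodExp_sub (F G : (ι → α) → ℝ) :
    prodExp w (fun z => F z - G z) = prodExp w F - prodExp w G := by
  simp [prodExp, mul_sub, Finset.sum_sub_distrib]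

theorem prodExp_const_mul (r : ℝ) (F : (ι → α) → ℝ) :
    prodExp w (fun z => r * F z) = r * prodExp w F := by
  simp only [prodExp, Finset.mul_sum]
  exact Finset.sum_congr rfl fun z _ => by ring

theorem prodExp_sum {κ : Type*} (s : Finset κ) (F : κ → (ι → α) → ℝ) :
    prodExp w (fun z => ∑ k ∈ s, F k z) = ∑ k ∈ s, prodExp w (F k) := by
  simp only [prodExp, Finset.mul_sum]
  exact Finset.sum_comm

theorem prodExp_nonneg (hw : ∀ a, 0 ≤ w a) {F : (ι → α) → ℝ} (h : ∀ z, 0 ≤ F z) :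
    0 ≤ prodExp w F :=
  Finset.sum_nonneg fun z _ => mul_nonneg (Finset.prod_nonneg fun _ _ => hw _) (h z)

/-- Resampling one coordinate does not change an expectation. -/
theorem prodExp_resample (hs : ∑ a, w a = 1) (j : ι) (F : (ι → α) → ℝ) :
    prodExp w F = prodExp w (fun z => ∑ a, w a * F (Function.update z j a)) := by
  have key : ∀ (z : ι → α) (a : α),
      (∏ i, w (z i)) * w a = (∏ i, w (Function.update z j a i)) * w (z j) := by
    intro z a
    rw [← Finset.mul_prod_erase _ _ (Finset.mem_univ j),
      ← Finset.mul_prod_erase _ (fun i => w (Function.update z j a i)) (Finset.mem_univ j)]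
    have : ∏ i ∈ Finset.univ.erase j, w (Function.update z j a i)
        = ∏ i ∈ Finset.univ.erase j, w (z i) :=
      Finset.prod_congr rfl fun i hi => by
        rw [Function.update_of_ne (Finset.ne_of_mem_erase hi)]
    rw [this, Function.update_self]
    ring
  symm
  calc prodExp w (fun z => ∑ a, w a * F (Function.update z j a))
      = ∑ p : (ι → α) × α, (∏ i, w (p.1 i)) * w p.2 * F (Function.update p.1 j p.2) := by
        rw [Fintype.sum_prod_type]
        simp only [prodExp, Finset.mul_sum, mul_assoc]
    _ = ∑ p : (ι → α) × α, (∏ i, w (p.1 i)) * w p.2 * F p.1 := by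
        -- Exchanging `z j` with the fresh value is an involution preserving the joint weight.
        refine Finset.sum_bij' (fun p _ => (Function.update p.1 j p.2, p.1 j))
          (fun p _ => (Function.update p.1 j p.2, p.1 j)) ?_ ?_ ?_ ?_ ?_
        · simp
        · simp
        · rintro ⟨z, a⟩ _; simp
        · rintro ⟨z, a⟩ _; simp
        · rintro ⟨z, a⟩ _
          exact congrArg (· * F (Function.update z j a)) (key z a)
    _ = prodExp w F := by
        rw [Fintype.sum_prod_type]
        simp only [prodExp]
        refine Finset.sum_congr rfl fun z _ => ?_
        rw [← Finset.sum_mul, ← Finset.mul_sum, hs, mul_one]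

theorem prodExp_coord (hs : ∑ a, w a = 1) (j : ι) (φ : α → ℝ) :
    prodExp w (fun z : ι → α => φ (z j)) = ∑ a, w a * φ a := by
  rw [prodExp_resample hs j]
  simp only [Function.update_self]
  exact prodExp_const hs _

theorem prodExp_perm (σ : Equiv.Perm α) (hσ : ∀ a, w (σ a) = w a) (F : (ι → α) → ℝ) :
    prodExp w (fun z => F (fun j => σ (z j))) = prodExp w F := by
  unfold prodExp
  rw [← (Equiv.piCongrRight fun _ : ι => σ).sum_comp fun z => (∏ j, w (z j)) * F z]
  refine Finset.sum_congr rfl fun z _ => ?_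
  simp only [Equiv.piCongrRight_apply, Pi.map_apply, hσ]
  rfl

theorem prodExp_cons {L : ℕ} (F : (Fin (L + 1) → α) → ℝ) :
    prodExp w F = ∑ a, w a * prodExp w (fun z : Fin L → α => F (Fin.cons a z)) := by
  unfold prodExp
  rw [← (Fin.consEquiv fun _ : Fin (L + 1) => α).sum_comp, Fintype.sum_prod_type]
  refine Finset.sum_congr rfl fun a _ => ?_
  rw [Finset.mul_sum]
  refine Finset.sum_congr rfl fun z _ => ?_
  simp [Fin.consEquiv, Fin.prod_univ_succ, mul_assoc]

end prodExp

theorem sum_toReal_pmf {α : Type*} [Fintype α] (D : PMF α) : ∑ a, (D a).toReal = 1 := by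
  rw [← ENNReal.toReal_sum fun a _ => D.apply_ne_top a, ← tsum_fintype (L := .unconditional α),
    D.tsum_coe, ENNReal.toReal_one]

/-! ### Acceptance probability and query count of composed decision trees -/

namespace OracleAlg

variable {n : ℕ}

/-- The probability that the algorithm accepts. -/
noncomputable def acc (f : BoolFun n) (D : PMF (Str n)) (A : OracleAlg n) : ℝ :=
  (A.run f D true).toReal

variable (f : BoolFun n) (D : PMF (Str n))

theorem bind_toReal {α : Type*} [Fintype α] (p : PMF α) (r : α → PMF Bool) :
    (p.bind r true).toReal = ∑ a, (p a).toReal * (r a true).toReal := by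
  rw [PMF.bind_apply, tsum_fintype, ENNReal.toReal_sum]
  · simp
  · exact fun a _ => ENNReal.mul_ne_top (p.apply_ne_top a) ((r a).apply_ne_top _)

@[simp] theorem acc_halt (b : Bool) : acc f D (halt b) = if b then 1 else 0 := by
  cases b <;> simp [acc, run]

@[simp] theorem acc_query (z : Str n) (next : Bool → OracleAlg n) :
    acc f D (query z next) = acc f D (next (f z)) := rfl

theorem acc_toss (k : ℕ) (next : Fin (k + 1) → OracleAlg n) :
    acc f D (toss k next) = ∑ i, (1 / ((k : ℝ) + 1)) * acc f D (next i) := by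
  unfold acc
  rw [run, bind_toReal]
  refine Finset.sum_congr rfl fun i _ => ?_
  rw [PMF.uniformOfFintype_apply, ENNReal.toReal_inv, Fintype.card_fin, ENNReal.toReal_natCast,
    Nat.cast_add, Nat.cast_one, one_div]

theorem acc_sample (next : Str n → Bool → OracleAlg n) :
    acc f D (sample next) = ∑ z, (D z).toReal * acc f D (next z (f z)) := by
  unfold acc
  rw [run, bind_toReal]

theorem run_false_toReal (A : OracleAlg n) : (A.run f D false).toReal = 1 - acc f D A := by
  have h := sum_toReal_pmf (A.run f D)
  rw [Fintype.sum_bool] at h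
  unfold acc
  linarith

theorem acc_nonneg (A : OracleAlg n) : 0 ≤ acc f D A := ENNReal.toReal_nonneg

/-- Run `A`, and if it accepts, run `B`. -/
def andThen : OracleAlg n → OracleAlg n → OracleAlg n
  | halt true, B => B
  | halt false, _ => halt false
  | toss k next, B => toss k fun i => andThen (next i) B
  | query z next, B => query z fun b => andThen (next b) B
  | sample next, B => sample fun z b => andThen (next z b) B

theorem acc_andThen (A B : OracleAlg n) :
    acc f D (andThen A B) = acc f D A * acc f D B := by
  induction A with
  | halt b => cases b <;> simp [andThen]
  | toss k next ih =>
    simp only [andThen, acc_toss, ih, Finset.sum_mul, mul_assoc]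
  | query z next ih => simp only [andThen, acc_query, ih]
  | sample next ih =>
    simp only [andThen, acc_sample, ih, Finset.sum_mul, mul_assoc]

theorem numQueries_toss_le {k N : ℕ} {next : Fin (k + 1) → OracleAlg n}
    (h : ∀ i, (next i).numQueries ≤ N) : (toss k next).numQueries ≤ N := by
  rw [numQueries]
  exact Finset.sup_le fun i _ => h i

theorem numQueries_query_le {z : Str n} {N : ℕ} {next : Bool → OracleAlg n}
    (h : ∀ b, (next b).numQueries ≤ N) : (query z next).numQueries ≤ 1 + N := by
  rw [numQueries]
  exact Nat.add_le_add_left (Finset.sup_le fun i _ => h i) 1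

theorem numQueries_sample_le {N : ℕ} {next : Str n → Bool → OracleAlg n}
    (h : ∀ z b, (next z b).numQueries ≤ N) : (sample next).numQueries ≤ 1 + N := by
  rw [numQueries]
  exact Nat.add_le_add_left (Finset.sup_le fun z _ => Finset.sup_le fun b _ => h z b) 1

theorem numQueries_andThen_le (A B : OracleAlg n) :
    (andThen A B).numQueries ≤ A.numQueries + B.numQueries := by
  induction A with
  | halt b => cases b <;> simp [andThen, numQueries]
  | toss k next ih =>
    refine numQueries_toss_le fun i => (ih i).trans ?_
    rw [numQueries]
    gcongr
    exact Finset.le_sup (f := fun i => numQueries (next i)) (Finset.mem_univ i)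
  | query z next ih =>
    rw [numQueries, add_assoc]
    refine numQueries_query_le fun b => (ih b).trans ?_
    gcongr
    exact Finset.le_sup (f := fun b => numQueries (next b)) (Finset.mem_univ b)
  | sample next ih =>
    rw [numQueries, add_assoc]
    refine numQueries_sample_le fun z b => (ih z b).trans ?_
    gcongr
    exact (Finset.le_sup (f := fun b => numQueries (next z b)) (Finset.mem_univ b)).trans
      (Finset.le_sup (f := fun z => Finset.univ.sup fun b => numQueries (next z b))
        (Finset.mem_univ z))

/-- Run the algorithms of the list one after the other; accept if all of them accept. -/
def andAll (l : List (OracleAlg n)) : OracleAlg n := l.foldr andThen (halt true)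

theorem acc_andAll (l : List (OracleAlg n)) :
    acc f D (andAll l) = (l.map (acc f D)).prod := by
  induction l with
  | nil => simp [andAll]
  | cons A l ih =>
    rw [andAll] at ih ⊢
    rw [List.foldr_cons, acc_andThen, ih, List.map_cons, List.prod_cons]

theorem numQueries_andAll_le {N : ℕ} {l : List (OracleAlg n)}
    (h : ∀ A ∈ l, A.numQueries ≤ N) : (andAll l).numQueries ≤ l.length * N := by
  induction l with
  | nil => simp [andAll, numQueries]
  | cons A l ih =>
    have h1 := numQueries_andThen_le A (andAll l)
    have h2 := ih fun B hB => h B (List.mem_cons_of_mem _ hB)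
    have h3 := h A List.mem_cons_self
    rw [List.length_cons, add_mul, one_mul, andAll, List.foldr_cons]
    rw [andAll] at h1 h2
    omega

/-- Draw `L` labelled samples. -/
def sampleMany : (L : ℕ) → ((Fin L → Str n) → (Fin L → Bool) → OracleAlg n) → OracleAlg n
  | 0, cont => cont Fin.elim0 Fin.elim0
  | L + 1, cont => sample fun z b =>
      sampleMany L fun zs bs => cont (Fin.cons z zs) (Fin.cons b bs)

/-- Draw `N` independent uniform elements of `Fin (k + 1)`. -/
def tossMany (k : ℕ) : (N : ℕ) → ((Fin N → Fin (k + 1)) → OracleAlg n) → OracleAlg n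
  | 0, cont => cont Fin.elim0
  | N + 1, cont => toss k fun i => tossMany k N fun is => cont (Fin.cons i is)

theorem acc_sampleMany (L : ℕ) (cont : (Fin L → Str n) → (Fin L → Bool) → OracleAlg n) :
    acc f D (sampleMany L cont) =
      prodExp (fun z => (D z).toReal) fun z => acc f D (cont z fun j => f (z j)) := by
  induction L with
  | zero =>
    simp only [sampleMany, prodExp, Finset.univ_unique, Finset.sum_singleton,
      Finset.univ_eq_empty, Finset.prod_empty, one_mul]
    congr 2
    exact Subsingleton.elim _ _
  | succ L ih =>
    rw [sampleMany, acc_sample, prodExp_cons]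
    refine Finset.sum_congr rfl fun z _ => ?_
    rw [ih]
    congr 2
    funext zs
    congr 2
    funext j
    refine Fin.cases ?_ (fun j => ?_) j <;> simp

theorem acc_tossMany (k N : ℕ) (cont : (Fin N → Fin (k + 1)) → OracleAlg n) :
    acc f D (tossMany k N cont) =
      prodExp (fun _ => 1 / ((k : ℝ) + 1)) fun c => acc f D (cont c) := by
  induction N with
  | zero =>
    simp only [tossMany, prodExp, Finset.univ_unique, Finset.sum_singleton,
      Finset.univ_eq_empty, Finset.prod_empty, one_mul]
    congr 2
  | succ L ih =>
    rw [tossMany, acc_toss, prodExp_cons]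
    refine Finset.sum_congr rfl fun z _ => ?_
    rw [ih]

theorem numQueries_sampleMany_le {L N : ℕ}
    {cont : (Fin L → Str n) → (Fin L → Bool) → OracleAlg n}
    (h : ∀ z b, (cont z b).numQueries ≤ N) : (sampleMany L cont).numQueries ≤ L + N := by
  induction L with
  | zero => simpa [sampleMany] using h _ _
  | succ L ih =>
    rw [sampleMany]
    have := numQueries_sample_le (N := L + N)
      (next := fun z b => sampleMany L fun zs bs => cont (Fin.cons z zs) (Fin.cons b bs))
      fun z b => ih fun zs bs => h _ _
    omega

theorem numQueries_tossMany_le {k M N : ℕ} {cont : (Fin M → Fin (k + 1)) → OracleAlg n}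
    (h : ∀ c, (cont c).numQueries ≤ N) : (tossMany k M cont).numQueries ≤ N := by
  induction M with
  | zero => exact h _
  | succ L ih =>
    rw [tossMany]
    exact numQueries_toss_le fun i => ih fun c => h _

end OracleAlg


/-! ### Probabilistic core: random colourings of unions of sets -/

section Core

open Classical in
/-- The indicator of a proposition. -/
noncomputable def ind (p : Prop) : ℝ := if p then 1 else 0

theorem ind_nonneg (p : Prop) : 0 ≤ ind p := by unfold ind; split <;> norm_num

theorem ind_of {p : Prop} (h : p) : ind p = 1 := if_pos h

theorem ind_of_not {p : Prop} (h : ¬p) : ind p = 0 := if_neg h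

theorem ind_mono {p q : Prop} (h : p → q) : ind p ≤ ind q := by
  by_cases hp : p
  · rw [ind_of hp, ind_of (h hp)]
  · rw [ind_of_not hp]; exact ind_nonneg q

theorem ind_and (p q : Prop) : ind (p ∧ q) = ind p * ind q := by
  by_cases hp : p <;> by_cases hq : q <;> simp [ind, hp, hq]

/-- The Bonferroni lower bound for a union, in the weak form with all ordered pairs. -/
theorem sum_ind_sub_le {ι : Type*} [Fintype ι] [DecidableEq ι] (E : ι → Prop) {R : Prop}
    (h : ∀ j, E j → R) :
    ∑ j, ind (E j) - ∑ j, ∑ l ∈ Finset.univ.erase j, ind (E j) * ind (E l) ≤ ind R := by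
  by_cases hE : ∃ j, E j
  · obtain ⟨j, hj⟩ := hE
    rw [ind_of (h j hj)]
    -- Row `j` of the double sum already cancels every indicator except that of `E j`.
    have h1 : ∑ l ∈ Finset.univ.erase j, ind (E j) * ind (E l)
        = ∑ l ∈ Finset.univ.erase j, ind (E l) :=
      Finset.sum_congr rfl fun l _ => by rw [ind_of hj, one_mul]
    have h2 := Finset.add_sum_erase Finset.univ (fun l => ind (E l)) (Finset.mem_univ j)
    have h3 : ∑ l ∈ Finset.univ.erase j, ind (E j) * ind (E l)
        ≤ ∑ j, ∑ l ∈ Finset.univ.erase j, ind (E j) * ind (E l) :=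
      Finset.single_le_sum (f := fun j => ∑ l ∈ Finset.univ.erase j, ind (E j) * ind (E l))
        (fun i _ => Finset.sum_nonneg fun l _ => mul_nonneg (ind_nonneg _) (ind_nonneg _))
        (Finset.mem_univ j)
    simp only [ind_of hj] at h2
    linarith
  · have : ∀ j, ind (E j) = 0 := fun j => ind_of_not fun hj => hE ⟨j, hj⟩
    simp only [this]
    simpa using ind_nonneg R

variable {V C : Type*} [DecidableEq V] [DecidableEq C]

/-- Inserting `i` into the part of `B` with colour `a` gives a set on which `g` is false, with
`i` itself coloured `a` and no other element of `Z` coloured `a`: a lower bound for the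
probability. -/
theorem colour_event_lower [Fintype V] [Fintype C] {δ : ℝ} (hδ : ∑ _ : C, δ = 1) (hδ0 : 0 ≤ δ) (g : Finset V → Bool)
    (B Z : Finset V) (i : V) (hi : i ∉ B) (a c₀ : C) :
    δ * (1 - δ * Z.card
      - prodExp (fun _ : C => δ) fun c : V → C => ind (g (insert i {e ∈ B | c e = c₀}) = true))
    ≤ prodExp (fun _ : C => δ) fun c : V → C =>
        ind (c i = a ∧ (∀ e ∈ Z, e ≠ i → c e ≠ a) ∧ g (insert i {e ∈ B | c e = a}) = false) := by
  have hu : ∀ _ : C, 0 ≤ δ := fun _ => hδ0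
  set K : (V → C) → ℝ := fun c =>
    ind ((∀ e ∈ Z, e ≠ i → c e ≠ a) ∧ g (insert i {e ∈ B | c e = a}) = false) with hK
  have hres : (prodExp (fun _ : C => δ) fun c : V → C =>
      ind (c i = a ∧ (∀ e ∈ Z, e ≠ i → c e ≠ a) ∧ g (insert i {e ∈ B | c e = a}) = false))
      = δ * prodExp (fun _ : C => δ) K := by
    -- The colour of `i` is independent of `K`: `i ∉ B`, and the condition on `Z` skips `i`.
    rw [prodExp_resample hδ i, ← prodExp_const_mul]
    congr 1
    funext c
    have : ∀ b, ind (Function.update c i b i = a ∧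
        (∀ e ∈ Z, e ≠ i → Function.update c i b e ≠ a) ∧
        g (insert i {e ∈ B | Function.update c i b e = a}) = false) = ind (b = a) * K c := by
      intro b
      have h1 : ∀ e, e ≠ i → Function.update c i b e = c e := fun e he =>
        Function.update_of_ne he _ _
      have h2 : ({e ∈ B | Function.update c i b e = a} : Finset V) = {e ∈ B | c e = a} :=
        Finset.filter_congr fun e he => by rw [h1 e (fun h => hi (h ▸ he))]
      have h3 : (∀ e ∈ Z, e ≠ i → Function.update c i b e ≠ a) ↔ ∀ e ∈ Z, e ≠ i → c e ≠ a :=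
        forall₃_congr fun e _ he => by rw [h1 e he]
      rw [ind_and, Function.update_self, h2, h3]
    simp only [this]
    rw [← Finset.mul_sum, ← Finset.sum_mul]
    have : ∑ b, ind (b = a) = 1 := by
      rw [Fintype.sum_eq_single a fun b hb => ind_of_not hb, ind_of rfl]
    rw [this, one_mul]
  rw [hres]
  refine mul_le_mul_of_nonneg_left ?_ hδ0
  -- Uniform colourings are invariant under exchanging two colours, so checking `c₀` alone gives
  -- information on every colour `a`.
  have hswap : (prodExp (fun _ : C => δ) fun c : V → C =>
      ind (g (insert i {e ∈ B | c e = c₀}) = true))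
      = prodExp (fun _ : C => δ) fun c : V → C =>
        ind (g (insert i {e ∈ B | c e = a}) = true) := by
    rw [← prodExp_perm (Equiv.swap c₀ a) (fun _ => rfl)]
    congr 1
    funext c
    congr 3
    congr 1
    refine Finset.filter_congr fun e _ => ?_
    rw [Equiv.swap_apply_eq_iff, Equiv.swap_apply_left]
  have hZ : (prodExp (fun _ : C => δ) fun c : V → C => ∑ e ∈ Z, ind (c e = a))
      = δ * Z.card := by
    rw [prodExp_sum]
    have : ∀ e, (prodExp (fun _ : C => δ) fun c : V → C => ind (c e = a)) = δ := fun e => by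
      rw [prodExp_coord hδ e (fun b => ind (b = a))]
      simp [ind]
    simp only [this]
    simp [mul_comm]
  rw [hswap, ← hZ, ← prodExp_const (ι := V) hδ 1, ← prodExp_sub, ← prodExp_sub]
  refine prodExp_mono hu fun c => ?_
  by_cases h1 : ∃ e ∈ Z, e ≠ i ∧ c e = a
  · obtain ⟨e, he, -, hc⟩ := h1
    have h4 : ind (c e = a) ≤ ∑ e ∈ Z, ind (c e = a) :=
      Finset.single_le_sum (f := fun e => ind (c e = a)) (fun _ _ => ind_nonneg _) he
    rw [ind_of hc] at h4
    have := ind_nonneg (g (insert i {e ∈ B | c e = a}) = true)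
    have := ind_nonneg ((∀ e ∈ Z, e ≠ i → c e ≠ a) ∧ g (insert i {e ∈ B | c e = a}) = false)
    simp only [hK]
    linarith
  · push Not at h1
    have h4 : 0 ≤ ∑ e ∈ Z, ind (c e = a) := Finset.sum_nonneg fun _ _ => ind_nonneg _
    by_cases h2 : g (insert i {e ∈ B | c e = a}) = true
    · have := ind_nonneg ((∀ e ∈ Z, e ≠ i → c e ≠ a) ∧ g (insert i {e ∈ B | c e = a}) = false)
      rw [ind_of h2]
      simp only [hK]
      linarith
    · rw [ind_of_not h2]
      simp only [hK]
      rw [ind_of ⟨h1, by simpa using h2⟩]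
      linarith

theorem colour_pair [Fintype V] [Fintype C] {δ : ℝ} (hδ : ∑ _ : C, δ = 1) (Q : Finset C) {i j : V} (hij : i ≠ j) :
    (prodExp (fun _ : C => δ) fun c : V → C => ind (c i ∈ Q) * ind (c j ∈ Q))
      = (δ * Q.card) ^ 2 := by
  have hQ : ∑ b : C, δ * ind (b ∈ Q) = δ * Q.card := by
    simp [ind, mul_comm]
  rw [prodExp_resample hδ i]
  simp only [Function.update_self, Function.update_of_ne hij.symm]
  have : ∀ c : V → C, ∑ b, δ * (ind (b ∈ Q) * ind (c j ∈ Q))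
      = (δ * Q.card) * ind (c j ∈ Q) := fun c => by
    rw [← hQ, Finset.sum_mul]
    exact Finset.sum_congr rfl fun b _ => by ring
  simp only [this]
  rw [prodExp_const_mul, prodExp_coord hδ j (fun b => ind (b ∈ Q)), hQ]
  ring

variable {α : Type*} {L : ℕ}

/-- The union of the sets `Y (z j)`. -/
def unionAll (Y : α → Finset V) (z : Fin L → α) : Finset V := Finset.univ.biUnion fun j => Y (z j)

/-- The union of the sets `Y (z j)` with `j ≠ J`. -/
def unionExcept (Y : α → Finset V) (z : Fin L → α) (J : Fin L) : Finset V :=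
  (Finset.univ.erase J).biUnion fun j => Y (z j)

theorem unionExcept_update (Y : α → Finset V) (z : Fin L → α) (J : Fin L) (y : α) :
    unionExcept Y (Function.update z J y) J = unionExcept Y z J :=
  Finset.biUnion_congr rfl fun j hj => by
    rw [Function.update_of_ne (Finset.ne_of_mem_erase hj)]

theorem unionAll_eq (Y : α → Finset V) (z : Fin L → α) (J : Fin L) :
    unionAll Y z = Y (z J) ∪ unionExcept Y z J := by
  unfold unionAll unionExcept
  conv_lhs => rw [← Finset.insert_erase (Finset.mem_univ J), Finset.biUnion_insert]

theorem subset_unionExcept (Y : α → Finset V) (z : Fin L → α) {j J : Fin L} (h : j ≠ J) :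
    Y (z j) ⊆ unionExcept Y z J :=
  Finset.subset_biUnion_of_mem (fun j => Y (z j)) (Finset.mem_erase.2 ⟨h, Finset.mem_univ j⟩)

/-- Elements private to different samples are disjoint, so the cost of isolation, summed over all
samples, is bounded independently of `L`. -/
theorem sum_card_sdiff_unionExcept_le [Fintype V] (Y : α → Finset V) (z : Fin L → α) :
    ∑ J, ((Y (z J) \ unionExcept Y z J).card : ℝ) ≤ Fintype.card V := by
  rw [← Nat.cast_sum, ← Finset.card_biUnion]
  · exact_mod_cast Finset.card_le_univ _
  · intro i _ j _ hij
    refine Finset.disjoint_left.2 fun e hi hj => ?_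
    rw [Finset.mem_sdiff] at hi hj
    exact hj.2 (subset_unionExcept Y z hij hi.1)

/-- The verdict on samples `z` and a colouring `c`: some colour class in `Q` of the union of the
positive samples is mapped to `false`, or some negative sample has a witness `h` that lies in the
union of the other positive samples, or that leaves `g` true when it is inserted into a colour
class of that union. -/
def Rejects (lab : α → Bool) (Y : α → Finset V) (h : α → V) (g : Finset V → Bool) (Q : Finset C)
    (c₀ : C) (z : Fin L → α) (c : V → C) : Prop :=
  (∃ a ∈ Q, g {e ∈ unionAll Y z | c e = a} = false) ∨
    ∃ J, lab (z J) = false ∧ (h (z J) ∈ unionExcept Y z J ∨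
      g (insert (h (z J)) {e ∈ unionExcept Y z J | c e = c₀}) = true)

/-- The failure event of the second kind for a fixed witness `i`. -/
def Clash (Y : α → Finset V) (g : Finset V → Bool) (c₀ : C) (J : Fin L) (i : V) (z : Fin L → α)
    (c : V → C) : Prop :=
  i ∈ unionExcept Y z J ∨ g (insert i {e ∈ unionExcept Y z J | c e = c₀}) = true

/-- The `J`-th sample contains a hidden element that is isolated in its colour class. -/
def Isolated (Y : α → Finset V) (g : Finset V → Bool) (Q : Finset C) (good : α → Prop) (ι : α → V)
    (J : Fin L) (z : Fin L → α) (c : V → C) : Prop :=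
  good (z J) ∧ ι (z J) ∉ unionExcept Y z J ∧ c (ι (z J)) ∈ Q ∧
    (∀ e ∈ Y (z J) \ unionExcept Y z J, e ≠ ι (z J) → c e ≠ c (ι (z J))) ∧
    g (insert (ι (z J)) {e ∈ unionExcept Y z J | c e = c (ι (z J))}) = false

/-- The isolated element is the only new one of its colour, so that colour class of the full union
is exactly the set on which `g` is already known to be false. -/
theorem Isolated.rejects {lab : α → Bool} {Y : α → Finset V} {h : α → V} {g : Finset V → Bool}
    {Q : Finset C} {c₀ : C} {good : α → Prop} {ι : α → V} (hι : ∀ y, good y → ι y ∈ Y y)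
    {J : Fin L} {z : Fin L → α} {c : V → C} (hI : Isolated Y g Q good ι J z c) :
    Rejects lab Y h g Q c₀ z c := by
  obtain ⟨h1, h2, h3, h4, h5⟩ := hI
  refine Or.inl ⟨_, h3, ?_⟩
  rw [← h5]
  congr 1
  ext e
  rw [unionAll_eq Y z J]
  simp only [Finset.mem_filter, Finset.mem_union, Finset.mem_insert]
  constructor
  · rintro ⟨h6, h7⟩
    by_cases he : e ∈ unionExcept Y z J
    · exact Or.inr ⟨he, h7⟩
    · refine Or.inl ?_
      by_contra hne
      exact h4 e (Finset.mem_sdiff.2 ⟨h6.resolve_right he, he⟩) hne h7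
  · rintro (rfl | ⟨h6, h7⟩)
    · exact ⟨Or.inl (hι _ h1), rfl⟩
    · exact ⟨Or.inr h6, h7⟩

variable [Fintype V] [Fintype C] [Fintype α] {w : α → ℝ} {δ : ℝ}

/-- The probability of `Clash`. -/
noncomputable def clashProb (w : α → ℝ) (δ : ℝ) (Y : α → Finset V) (g : Finset V → Bool) (c₀ : C)
    (J : Fin L) (i : V) : ℝ :=
  prodExp w fun z : Fin L → α => prodExp (fun _ : C => δ) fun c : V → C => ind (Clash Y g c₀ J i z c)

theorem clashProb_nonneg (hw : ∀ a, 0 ≤ w a) (hδ0 : 0 ≤ δ) (Y : α → Finset V)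
    (g : Finset V → Bool) (c₀ : C) (J : Fin L) (i : V) : 0 ≤ clashProb w δ Y g c₀ J i :=
  prodExp_nonneg hw fun _ => prodExp_nonneg (fun _ => hδ0) fun _ => ind_nonneg _

/-- The probability of `Clash` at a witness computed from the `J`-th sample. -/
theorem prodExp_clash (hs : ∑ a, w a = 1) (Y : α → Finset V) (g : Finset V → Bool) (c₀ : C)
    (J : Fin L) (s : α → Prop) (h : α → V) :
    (prodExp w fun z : Fin L → α => ind (s (z J)) * prodExp (fun _ : C => δ) fun c : V → C =>
      ind (Clash Y g c₀ J (h (z J)) z c)) =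
    ∑ y, w y * (ind (s y) * clashProb w δ Y g c₀ J (h y)) := by
  rw [prodExp_resample hs J, prodExp_sum]
  -- `Clash` ignores the `J`-th sample, so its witness may be treated as independent of the rest.
  refine Finset.sum_congr rfl fun y _ => ?_
  simp only [Function.update_self, Clash, unionExcept_update]
  rw [prodExp_const_mul, prodExp_const_mul, clashProb]
  rfl

theorem sum_clashProb_le (hw : ∀ a, 0 ≤ w a) (hs : ∑ a, w a = 1) (hδ0 : 0 ≤ δ) (lab : α → Bool)
    (Y : α → Finset V) (h : α → V) (g : Finset V → Bool) (Q : Finset C) (c₀ : C) (J : Fin L) :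
    ∑ y, w y * (ind (lab y = false) * clashProb w δ Y g c₀ J (h y)) ≤
      prodExp w fun z : Fin L → α => prodExp (fun _ : C => δ) fun c : V → C =>
        ind (Rejects lab Y h g Q c₀ z c) := by
  rw [← prodExp_clash hs Y g c₀ J (fun y => lab y = false) h]
  refine prodExp_mono hw fun z => ?_
  rw [← prodExp_const_mul]
  refine prodExp_mono (fun _ => hδ0) fun c => ?_
  rw [← ind_and]
  exact ind_mono fun hc => Or.inr ⟨J, hc⟩

/-- Sum `colour_event_lower` over the tested colours, with `B` the union of the other samples and
`Z` the private part of sample `J`. -/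
theorem isolated_lower (hw : ∀ a, 0 ≤ w a) (hs : ∑ a, w a = 1) (hδ : ∑ _ : C, δ = 1)
    (hδ0 : 0 ≤ δ) (Y : α → Finset V) (g : Finset V → Bool) (Q : Finset C) (c₀ : C)
    (good : α → Prop) (ι : α → V) (J : Fin L) :
    δ * Q.card * (∑ y, w y * (ind (good y) * (1 - clashProb w δ Y g c₀ J (ι y)))
      - δ * prodExp w fun z : Fin L → α => ((Y (z J) \ unionExcept Y z J).card : ℝ)) ≤
      prodExp w fun z : Fin L → α => prodExp (fun _ : C => δ) fun c : V → C =>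
        ind (Isolated Y g Q good ι J z c) := by
  have h1 : ∑ y, w y * (ind (good y) * (1 - clashProb w δ Y g c₀ J (ι y))) =
      prodExp w fun z : Fin L → α => ind (good (z J)) * (1 - prodExp (fun _ : C => δ)
        fun c : V → C => ind (Clash Y g c₀ J (ι (z J)) z c)) := by
    simp only [mul_sub, mul_one]
    rw [prodExp_sub, prodExp_clash hs, prodExp_coord hs J (fun y => ind (good y)),
      Finset.sum_sub_distrib]
  rw [h1, ← prodExp_const_mul, ← prodExp_sub, ← prodExp_const_mul]
  refine prodExp_mono hw fun z => ?_
  have hd : (0 : ℝ) ≤ δ * Q.card := by positivity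
  have hr : 0 ≤ prodExp (fun _ : C => δ) fun c : V → C => ind (Isolated Y g Q good ι J z c) :=
    prodExp_nonneg (fun _ => hδ0) fun _ => ind_nonneg _
  have hcard : 0 ≤ δ * ((Y (z J) \ unionExcept Y z J).card : ℝ) := by positivity
  by_cases hg : good (z J)
  · rw [ind_of hg, one_mul]
    by_cases hi : ι (z J) ∈ unionExcept Y z J
    -- Here a clash is certain, so the lower bound is nonpositive.
    · have : (prodExp (fun _ : C => δ) fun c : V → C => ind (Clash Y g c₀ J (ι (z J)) z c))
          = 1 := by
        have : ∀ c : V → C, ind (Clash Y g c₀ J (ι (z J)) z c) = 1 := fun c =>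
          ind_of (Or.inl hi)
        simp only [this]
        exact prodExp_const hδ 1
      rw [this]
      exact (mul_nonpos_of_nonneg_of_nonpos hd (by linarith)).trans hr
    · have h2 : ∀ c : V → C, ind (Isolated Y g Q good ι J z c) =
          ∑ a ∈ Q, ind (c (ι (z J)) = a ∧
            (∀ e ∈ Y (z J) \ unionExcept Y z J, e ≠ ι (z J) → c e ≠ a) ∧
            g (insert (ι (z J)) {e ∈ unionExcept Y z J | c e = a}) = false) := by
        intro c
        simp only [ind_and (_ = _) _]
        by_cases hQ : c (ι (z J)) ∈ Q
        · rw [Finset.sum_eq_single_of_mem _ hQ, ind_of rfl, one_mul]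
          · simp only [Isolated, hg, hi, hQ, not_false_eq_true, true_and]
          · intro b _ hb
            rw [ind_of_not hb.symm, zero_mul]
        · rw [Finset.sum_eq_zero, ind_of_not fun hI => hQ hI.2.2.1]
          intro b hb
          have hne : c (ι (z J)) ≠ b := fun h => hQ (h ▸ hb)
          rw [ind_of_not hne, zero_mul]
      simp only [h2]
      rw [prodExp_sum]
      have h3 := fun a => colour_event_lower hδ hδ0 g (unionExcept Y z J)
        (Y (z J) \ unionExcept Y z J) (ι (z J)) hi a c₀
      have h4 := Finset.sum_le_sum fun a (_ : a ∈ Q) => h3 a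
      refine le_trans (le_of_eq ?_) h4
      rw [Finset.sum_const, nsmul_eq_mul]
      have h5 : ∀ c : V → C, ind (Clash Y g c₀ J (ι (z J)) z c) =
          ind (g (insert (ι (z J)) {e ∈ unionExcept Y z J | c e = c₀}) = true) := fun c => by
        simp only [Clash, hi, false_or]
      simp only [h5]
      ring
  · rw [ind_of_not hg, zero_mul]
    exact (mul_nonpos_of_nonneg_of_nonpos hd (by linarith)).trans hr

/-- Each hidden element lies outside the union of the other samples, so the two are distinct and
their colours independent. Keeping goodness of one sample only is enough for the second moment. -/
theorem isolated_pair_upper (hw : ∀ a, 0 ≤ w a) (hs : ∑ a, w a = 1) (hδ : ∑ _ : C, δ = 1)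
    (hδ0 : 0 ≤ δ) (Y : α → Finset V) (g : Finset V → Bool) (Q : Finset C)
    {good : α → Prop} {ι : α → V} (hι : ∀ y, good y → ι y ∈ Y y) {J J' : Fin L} (hJ : J' ≠ J) :
    (prodExp w fun z : Fin L → α => prodExp (fun _ : C => δ) fun c : V → C =>
        ind (Isolated Y g Q good ι J z c) * ind (Isolated Y g Q good ι J' z c)) ≤
      (∑ y, w y * ind (good y)) * (δ * Q.card) ^ 2 := by
  rw [← prodExp_coord hs J (fun y => ind (good y)), mul_comm, ← prodExp_const_mul]
  refine prodExp_mono hw fun z => ?_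
  by_cases hz : good (z J) ∧ good (z J') ∧ ι (z J) ∉ unionExcept Y z J
  · obtain ⟨hg, hg', hi⟩ := hz
    have hne : ι (z J) ≠ ι (z J') := fun h =>
      hi (by rw [h]; exact subset_unionExcept Y z hJ (hι _ hg'))
    rw [ind_of hg, mul_one, ← colour_pair hδ Q hne]
    refine prodExp_mono (fun _ => hδ0) fun c => ?_
    exact mul_le_mul (ind_mono fun h => h.2.2.1) (ind_mono fun h => h.2.2.1) (ind_nonneg _)
      (ind_nonneg _)
  · have : ∀ c : V → C,
        ind (Isolated Y g Q good ι J z c) * ind (Isolated Y g Q good ι J' z c) = 0 := by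
      intro c
      rw [← ind_and]
      exact ind_of_not fun h => hz ⟨h.1.1, h.2.1, h.1.2.1⟩
    simp only [this]
    rw [prodExp_const hδ]
    exact mul_nonneg (sq_nonneg _) (ind_nonneg _)

/-- If every set `S` is missed by the witnesses of negative samples or hit by positive samples with
total probability at least `ε`, then the verdict is a rejection with probability of order `ε ^ 2`,
when the numbers of samples, colours, and tested colours are balanced. -/
theorem rejects_lower (hw : ∀ a, 0 ≤ w a) (hs : ∑ a, w a = 1) (hδ : ∑ _ : C, δ = 1)
    (hδ0 : 0 ≤ δ) (lab : α → Bool) (Y : α → Finset V) (h : α → V) (g : Finset V → Bool)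
    (Q : Finset C) (c₀ : C) {ε : ℝ} (hε0 : 0 < ε) (hε1 : ε ≤ 1)
    (hfar : ∀ S : Finset V, ε ≤ ∑ y, w y * ind (lab y = false ∧ h y ∉ S)
      + ∑ y, w y * ind (∃ i ∈ Y y, i ∈ S))
    (hL : 0 < L) (hm : 20 * (Fintype.card V * δ) ≤ L * ε)
    (hx : L * (δ * Q.card) ≤ 2 / 5) (hx' : ε / 21 ≤ L * (δ * Q.card)) :
    ε ^ 2 / 200 ≤ prodExp w fun z : Fin L → α => prodExp (fun _ : C => δ) fun c : V → C =>
        ind (Rejects lab Y h g Q c₀ z c) := by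
  classical
  set ρ := prodExp w fun z : Fin L → α => prodExp (fun _ : C => δ) fun c : V → C =>
        ind (Rejects lab Y h g Q c₀ z c) with hρ
  by_contra! hlt
  have hLr : (0 : ℝ) < L := by exact_mod_cast hL
  set A : V → ℝ := fun i => ∑ J : Fin L, clashProb w δ Y g c₀ J i with hA
  -- The test set: elements whose clash probability, averaged over the `L` positions, is at most
  -- 1/10.
  set S : Finset V := {i | A i ≤ L / 10} with hS
  have hA0 : ∀ i, 0 ≤ A i := fun i =>
    Finset.sum_nonneg fun J _ => clashProb_nonneg hw hδ0 Y g c₀ J i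
  have h1 : ∑ y, w y * (ind (lab y = false) * A (h y)) ≤ L * ρ := by
    have := Finset.sum_le_sum fun (J : Fin L) (_ : J ∈ Finset.univ) =>
      sum_clashProb_le hw hs hδ0 lab Y h g Q c₀ J
    rw [Finset.sum_const, Finset.card_univ, Fintype.card_fin, nsmul_eq_mul,
      Finset.sum_comm] at this
    refine le_trans (le_of_eq ?_) this
    refine Finset.sum_congr rfl fun y _ => ?_
    rw [hA, Finset.mul_sum, Finset.mul_sum]
  have h2 : L / 10 * ∑ y, w y * ind (lab y = false ∧ h y ∉ S) ≤ L * ρ := by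
    refine le_trans ?_ h1
    rw [Finset.mul_sum]
    refine Finset.sum_le_sum fun y _ => ?_
    rw [ind_and, mul_left_comm]
    refine mul_le_mul_of_nonneg_left ?_ (hw y)
    rw [mul_left_comm]
    refine mul_le_mul_of_nonneg_left ?_ (ind_nonneg _)
    by_cases hy : h y ∈ S
    · rw [ind_of_not (not_not.2 hy), mul_zero]
      exact hA0 _
    · rw [ind_of hy, mul_one]
      simp only [hS, Finset.mem_filter, Finset.mem_univ, true_and, not_le] at hy
      exact hy.le
  have h3 : ∑ y, w y * ind (lab y = false ∧ h y ∉ S) ≤ 10 * ρ := by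
    have : L * (∑ y, w y * ind (lab y = false ∧ h y ∉ S)) ≤ L * (10 * ρ) := by linarith
    exact le_of_mul_le_mul_left this hLr
  set good : α → Prop := fun y => ∃ i ∈ Y y, i ∈ S with hgood
  set γ := ∑ y, w y * ind (good y) with hγ
  -- Witnesses miss `S` with probability at most `10 * ρ < ε ^ 2 / 20 ≤ ε / 2`.
  have h4 : ε / 2 ≤ γ := by
    have := hfar S
    nlinarith
  have hγ0 : 0 < γ := by linarith
  obtain ⟨i₀⟩ : Nonempty V := by
    by_contra hne
    have : ∀ y, ind (good y) = 0 := fun y => ind_of_not fun ⟨i, _⟩ => hne ⟨i⟩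
    simp [hγ, this] at hγ0
  have hex : ∀ y, ∃ i, good y → i ∈ Y y ∧ i ∈ S := fun y => by
    by_cases hy : good y
    · obtain ⟨i, hi⟩ := hy
      exact ⟨i, fun _ => hi⟩
    · exact ⟨i₀, fun h => absurd h hy⟩
  choose ι hι using hex
  have hιY : ∀ y, good y → ι y ∈ Y y := fun y hy => (hι y hy).1
  set x := δ * Q.card with hxdef
  have hx0 : 0 ≤ x := by positivity
  -- The factor 9/10 is one minus the clash threshold defining `S`.
  have hlow : x * (9 / 10 * (L * γ) - δ * Fintype.card V) ≤
      ∑ J : Fin L, prodExp w fun z : Fin L → α => prodExp (fun _ : C => δ) fun c : V → C =>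
        ind (Isolated Y g Q good ι J z c) := by
    refine le_trans ?_ (Finset.sum_le_sum fun J _ =>
      isolated_lower hw hs hδ hδ0 Y g Q c₀ good ι J)
    rw [← Finset.mul_sum]
    refine mul_le_mul_of_nonneg_left ?_ hx0
    rw [Finset.sum_sub_distrib, ← Finset.mul_sum, ← prodExp_sum]
    refine sub_le_sub ?_ (mul_le_mul_of_nonneg_left ?_ hδ0)
    · rw [Finset.sum_comm, hγ, Finset.mul_sum, Finset.mul_sum]
      refine Finset.sum_le_sum fun y _ => ?_
      rw [← Finset.mul_sum, ← Finset.mul_sum,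
        show 9 / 10 * (L * (w y * ind (good y))) = w y * (ind (good y) * (9 / 10 * L)) by ring]
      refine mul_le_mul_of_nonneg_left ?_ (hw y)
      by_cases hy : good y
      · have hi := (hι y hy).2
        simp only [hS, Finset.mem_filter, Finset.mem_univ, true_and, hA] at hi
        refine (mul_le_mul_of_nonneg_left ?_ (ind_nonneg _))
        rw [Finset.sum_sub_distrib, Finset.sum_const, Finset.card_univ, Fintype.card_fin,
          nsmul_eq_mul]
        linarith
      · rw [ind_of_not hy]
        simp
    · refine (prodExp_mono hw fun z => sum_card_sdiff_unionExcept_le Y z).trans ?_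
      rw [prodExp_const hs]
  have hup : ∑ J : Fin L, ∑ J' ∈ Finset.univ.erase J,
      (prodExp w fun z : Fin L → α => prodExp (fun _ : C => δ) fun c : V → C =>
        ind (Isolated Y g Q good ι J z c) * ind (Isolated Y g Q good ι J' z c)) ≤
      L * (L * (γ * x ^ 2)) := by
    have hnn : 0 ≤ γ * x ^ 2 := by positivity
    refine (Finset.sum_le_card_nsmul _ _ (L * (γ * x ^ 2)) fun J _ => ?_).trans
      (by rw [Finset.card_univ, Fintype.card_fin, nsmul_eq_mul])
    refine (Finset.sum_le_card_nsmul _ _ (γ * x ^ 2) fun J' hJ' =>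
      isolated_pair_upper hw hs hδ hδ0 Y g Q hιY (Finset.ne_of_mem_erase hJ')).trans ?_
    rw [nsmul_eq_mul]
    refine mul_le_mul_of_nonneg_right ?_ hnn
    exact_mod_cast (Finset.card_le_univ _).trans (Fintype.card_fin L).le
  have hrej : (∑ J : Fin L, prodExp w fun z : Fin L → α => prodExp (fun _ : C => δ)
        fun c : V → C => ind (Isolated Y g Q good ι J z c)) -
      ∑ J : Fin L, ∑ J' ∈ Finset.univ.erase J,
      (prodExp w fun z : Fin L → α => prodExp (fun _ : C => δ) fun c : V → C =>
        ind (Isolated Y g Q good ι J z c) * ind (Isolated Y g Q good ι J' z c)) ≤ ρ := by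
    simp only [← prodExp_sum]
    rw [← prodExp_sub]
    refine prodExp_mono hw fun z => ?_
    rw [← prodExp_sub]
    refine prodExp_mono (fun _ => hδ0) fun c => ?_
    exact sum_ind_sub_le (fun J => Isolated Y g Q good ι J z c) fun J hJ => hJ.rejects hιY
  have h5 : δ * Fintype.card V ≤ L * γ / 10 := by
    have : (L : ℝ) * ε ≤ L * (2 * γ) := mul_le_mul_of_nonneg_left (by linarith) hLr.le
    linarith
  have h6 : x * (8 / 10 * (L * γ)) ≤ x * (9 / 10 * (L * γ) - δ * Fintype.card V) :=
    mul_le_mul_of_nonneg_left (by linarith) hx0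
  have h7 : (L * x) * (γ * (L * x)) ≤ 2 / 5 * (γ * (L * x)) :=
    mul_le_mul_of_nonneg_right hx (by positivity)
  have h8 : (ε / 2) * (ε / 21) ≤ γ * (L * x) := mul_le_mul h4 hx' (by positivity) hγ0.le
  -- The first moment `8/10 * γ * L * x` minus the pair term `4/10 * γ * L * x` leaves at least `ε ^
  -- 2 / 105`, contradicting `hlt`.
  nlinarith

end Core


/-! ### Binary search for witnesses, and conjunctions relative to a reference string -/

section Search

variable {n : ℕ}

/-- The coordinates on which `z` differs from the reference string `r`. -/
def diffSet (r z : Str n) : Finset (Fin n) := {e | z e ≠ r e}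

/-- The string `r` with the coordinates in `A` flipped. -/
def flipOn (r : Str n) (A : Finset (Fin n)) : Str n := fun e => if e ∈ A then !r e else r e

/-- The string that agrees with `x` on the first `t` coordinates and with `r` elsewhere. -/
def hybrid (r x : Str n) (t : ℕ) : Str n := fun e => if e.val < t then x e else r e

theorem flipOn_eq_iff (r : Str n) (A : Finset (Fin n)) (e : Fin n) :
    flipOn r A e = r e ↔ e ∉ A := by
  unfold flipOn
  split <;> simp [*]

theorem hybrid_zero (r x : Str n) : hybrid r x 0 = r := by
  funext e; simp [hybrid]

theorem hybrid_of_le (r x : Str n) {t : ℕ} (h : n ≤ t) : hybrid r x t = x := by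
  funext e; simp [hybrid, e.isLt.trans_le h]

theorem hybrid_succ_of_ne (r x : Str n) {t : ℕ} {e : Fin n} (h : e.val ≠ t) :
    hybrid r x (t + 1) e = hybrid r x t e := by
  have : e.val < t + 1 ↔ e.val < t := by omega
  simp [hybrid, this]

/-- Binary search on `[lo, lo + 2 ^ k]` for a place where `f` changes from `true` to `false` along
the hybrids. -/
def searchVal (f : BoolFun n) (r x : Str n) : ℕ → ℕ → ℕ
  | 0, lo => lo
  | k + 1, lo =>
    if f (hybrid r x (lo + 2 ^ k)) then searchVal f r x k (lo + 2 ^ k) else searchVal f r x k lo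

theorem searchVal_spec (f : BoolFun n) (r x : Str n) (k lo : ℕ)
    (h1 : f (hybrid r x lo) = true) (h2 : f (hybrid r x (lo + 2 ^ k)) = false) :
    f (hybrid r x (searchVal f r x k lo)) = true ∧
      f (hybrid r x (searchVal f r x k lo + 1)) = false := by
  induction k generalizing lo with
  | zero => exact ⟨h1, h2⟩
  | succ k ih =>
    rw [searchVal]
    split
    · rename_i h
      refine ih _ h ?_
      rwa [add_assoc, ← two_mul, ← pow_succ']
    · rename_i h
      exact ih _ h1 (by simpa using h)

/-- A coordinate found by binary search between `r` and `x`. -/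
def witness [NeZero n] (f : BoolFun n) (r x : Str n) : Fin n :=
  Fin.ofNat n (searchVal f r x (Nat.log 2 n + 1) 0)

/-- The two hybrids at the end of the search have different values and can differ only at the
witness. The first claim needs no structure of `f`; the second is the completeness of the negative
checks. -/
theorem witness_spec [NeZero n] {f : BoolFun n} {r x : Str n} (hr : f r = true)
    (hx : f x = false) : x (witness f r x) ≠ r (witness f r x) ∧
      ∀ U : Finset (Fin n), (∀ z, f z = true ↔ ∀ e ∈ U, z e = r e) → witness f r x ∈ U := by
  -- The search interval may overshoot `n`; the hybrids there all equal `x`.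
  have hn : n ≤ 0 + 2 ^ (Nat.log 2 n + 1) := by
    rw [zero_add]; exact (Nat.lt_pow_succ_log_self (by norm_num) n).le
  obtain ⟨h1, h2⟩ := searchVal_spec f r x (Nat.log 2 n + 1) 0
    (by rwa [hybrid_zero]) (by rwa [hybrid_of_le r x hn])
  set v := searchVal f r x (Nat.log 2 n + 1) 0 with hv
  have hvn : v < n := by
    by_contra! hle
    rw [hybrid_of_le r x hle, hx] at h1
    exact absurd h1 (by simp)
  have hw : (witness f r x).val = v := by
    rw [witness, ← hv, Fin.val_ofNat, Nat.mod_eq_of_lt hvn]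
  have hother : ∀ e, e ≠ witness f r x → hybrid r x (v + 1) e = hybrid r x v e := fun e he =>
    hybrid_succ_of_ne r x fun h => he (Fin.ext (h.trans hw.symm))
  constructor
  · intro heq
    have : hybrid r x (v + 1) = hybrid r x v := by
      funext e
      by_cases he : e = witness f r x
      · subst he
        simp [hybrid, hw, heq]
      · exact hother e he
    rw [this, h1] at h2
    exact absurd h2 (by simp)
  · intro U hU
    by_contra hnot
    have : f (hybrid r x (v + 1)) = true := by
      rw [hU] at h1 ⊢
      intro e he
      rw [hother e fun h => hnot (h ▸ he), h1 e he]
    rw [this] at h2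
    exact absurd h2 (by simp)

theorem exists_support_of_mem_conj {f : BoolFun n} (hf : f ∈ conj n) {r : Str n}
    (hr : f r = true) : ∃ U : Finset (Fin n), ∀ z, f z = true ↔ ∀ e ∈ U, z e = r e := by
  obtain ⟨S, S', h⟩ := hf
  obtain ⟨h1, h2⟩ := (h r).1 hr
  refine ⟨S ∪ S', fun z => (h z).trans ?_⟩
  constructor
  · rintro ⟨h3, h4⟩ e he
    rcases Finset.mem_union.1 he with he | he
    · rw [h3 e he, h1 e he]
    · rw [h4 e he, h2 e he]
  · intro h3
    exact ⟨fun e he => (h3 e (Finset.mem_union_left _ he)).trans (h1 e he),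
      fun e he => (h3 e (Finset.mem_union_right _ he)).trans (h2 e he)⟩

/-- The competitor to which farness is applied, with `S` chosen in `rejects_lower`. -/
theorem agree_mem_conj (r : Str n) (S : Finset (Fin n)) :
    (fun z => decide (∀ e ∈ S, z e = r e)) ∈ conj n := by
  refine ⟨{e ∈ S | r e = true}, {e ∈ S | r e = false}, fun z => ?_⟩
  simp only [decide_eq_true_eq, Finset.mem_filter, and_imp]
  constructor
  · exact fun h => ⟨fun e he hr => (h e he).trans hr, fun e he hr => (h e he).trans hr⟩
  · rintro ⟨h1, h2⟩ e he
    cases hr : r e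
    · exact h2 e he hr
    · exact h1 e he hr

theorem const_false_mem_conj [NeZero n] : (fun _ => false) ∈ conj n := by
  refine ⟨Finset.univ, Finset.univ, fun z => ?_⟩
  simp only [Bool.false_eq_true, Finset.mem_univ, true_implies, false_iff, not_and]
  intro h1 h2
  have := h1 0
  rw [h2 0] at this
  exact absurd this (by simp)

theorem IsFar.le_dist {ε : ℝ} {D : PMF (Str n)} {f g : BoolFun n} {C : Set (BoolFun n)}
    (h : IsFar ε D f C) (hg : g ∈ C) : ε ≤ dist D f g := by
  refine le_trans h (ciInf_le ⟨0, ?_⟩ (⟨g, hg⟩ : C))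
  rintro _ ⟨g', rfl⟩
  refine Finset.sum_nonneg fun z _ => ?_
  split
  · exact ENNReal.toReal_nonneg
  · exact le_rfl

theorem dist_eq_sum_ind (D : PMF (Str n)) (f g : BoolFun n) :
    dist D f g = ∑ z, (D z).toReal * ind (f z ≠ g z) := by
  refine Finset.sum_congr rfl fun z _ => ?_
  by_cases h : f z = g z <;> simp [ind, h]

end Search

/-! ### One round of the tester -/

namespace OracleAlg

variable {n : ℕ}

/-- The binary search `searchVal` as an oracle algorithm. -/
def search (r x : Str n) : ℕ → ℕ → (ℕ → OracleAlg n) → OracleAlg n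
  | 0, lo, cont => cont lo
  | k + 1, lo, cont => query (hybrid r x (lo + 2 ^ k)) fun b =>
      if b then search r x k (lo + 2 ^ k) cont else search r x k lo cont

theorem acc_search (f : BoolFun n) (D : PMF (Str n)) (r x : Str n) (k lo : ℕ)
    (cont : ℕ → OracleAlg n) :
    acc f D (search r x k lo cont) = acc f D (cont (searchVal f r x k lo)) := by
  induction k generalizing lo with
  | zero => rfl
  | succ k ih =>
    rw [search, acc_query, searchVal]
    split <;> exact ih _

theorem numQueries_search_le (r x : Str n) (k lo : ℕ) {cont : ℕ → OracleAlg n} {N : ℕ}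
    (h : ∀ v, (cont v).numQueries ≤ N) : (search r x k lo cont).numQueries ≤ k + N := by
  induction k generalizing lo with
  | zero => simpa [search] using h lo
  | succ k ih =>
    rw [search]
    refine (numQueries_query_le (N := k + N) fun b => ?_).trans (by omega)
    split <;> exact ih _

/-- The positive part of a labelled sample: the differences from `r` if the label is `true`. -/
def posDiff (r : Str n) (p : Str n × Bool) : Finset (Fin n) := if p.2 then diffSet r p.1 else ∅

/-- Check that a negative sample `x` is consistent with the union `B` of positive samples and its
colour class `P`. -/
def negCheck [NeZero n] (r x : Str n) (B P : Finset (Fin n)) : OracleAlg n :=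
  search r x (Nat.log 2 n + 1) 0 fun v =>
    if Fin.ofNat n v ∈ B then halt false
    else query (flipOn r (insert (Fin.ofNat n v) P)) fun b => halt (!b)

/-- All the checks made for a reference string `r`, labelled samples `p` and a colouring `c`. -/
noncomputable def checks [NeZero n] {L k : ℕ} (Q : Finset (Fin (k + 1))) (r : Str n)
    (p : Fin L → Str n × Bool) (c : Fin n → Fin (k + 1)) : OracleAlg n :=
  andAll ((Q.toList.map fun a =>
      query (flipOn r {e ∈ unionAll (posDiff r) p | c e = a}) halt) ++
    List.ofFn fun J => if (p J).2 then halt true else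
      negCheck r (p J).1 (unionExcept (posDiff r) p J)
        {e ∈ unionExcept (posDiff r) p J | c e = 0})

/-- One round of the tester: draw a reference string, and if it is positive, draw samples and a
colouring and make all the checks. -/
noncomputable def round (n : ℕ) [NeZero n] (L k : ℕ) (Q : Finset (Fin (k + 1))) : OracleAlg n :=
  sample fun r b => if b then
    sampleMany L fun z lab => tossMany k n fun c => checks Q r (fun j => (z j, lab j)) c
  else halt true

theorem numQueries_checks_le [NeZero n] {L k : ℕ} (Q : Finset (Fin (k + 1))) (r : Str n)
    (p : Fin L → Str n × Bool) (c : Fin n → Fin (k + 1)) :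
    (checks Q r p c).numQueries ≤ (Q.card + L) * (Nat.log 2 n + 2) := by
  refine (numQueries_andAll_le (N := Nat.log 2 n + 2) ?_).trans (by simp)
  intro A hA
  rcases List.mem_append.1 hA with hA | hA
  · obtain ⟨a, -, rfl⟩ := List.mem_map.1 hA
    exact (numQueries_query_le (N := 0) fun b => by simp [numQueries]).trans (by omega)
  · obtain ⟨J, rfl⟩ := (List.mem_ofFn' _ _).1 hA
    dsimp only
    split
    · simp [numQueries]
    · refine (numQueries_search_le (N := 1) _ _ _ _ fun v => ?_).trans (by omega)
      split
      · simp [numQueries]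
      · exact (numQueries_query_le (N := 0) fun b => by simp [numQueries])

theorem numQueries_round_le [NeZero n] (L k : ℕ) (Q : Finset (Fin (k + 1))) :
    (round n L k Q).numQueries ≤ 1 + (L + (Q.card + L) * (Nat.log 2 n + 2)) := by
  refine numQueries_sample_le fun r b => ?_
  split
  · exact numQueries_sampleMany_le fun z lab => numQueries_tossMany_le fun c =>
      numQueries_checks_le Q r _ c
  · simp [numQueries]

/-- The event that a round with reference string `r` rejects. -/
def RoundRejects [NeZero n] {L k : ℕ} (f : BoolFun n) (Q : Finset (Fin (k + 1))) (r : Str n)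
    (z : Fin L → Str n) (c : Fin n → Fin (k + 1)) : Prop :=
  Rejects f (fun y => posDiff r (y, f y)) (witness f r) (fun A => f (flipOn r A)) Q 0 z c

theorem acc_negCheck [NeZero n] (f : BoolFun n) (D : PMF (Str n)) (r x : Str n)
    (B P : Finset (Fin n)) : acc f D (negCheck r x B P) =
      1 - ind (witness f r x ∈ B ∨ f (flipOn r (insert (witness f r x) P)) = true) := by
  rw [negCheck, acc_search]
  change acc f D (if witness f r x ∈ B then halt false
    else query (flipOn r (insert (witness f r x) P)) fun b => halt (!b)) = _
  split
  · rename_i h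
    simp [ind, h]
  · rename_i h
    cases hf : f (flipOn r (insert (witness f r x) P)) <;> simp [ind, h, hf]

theorem acc_checks [NeZero n] (f : BoolFun n) (D : PMF (Str n)) {L k : ℕ}
    (Q : Finset (Fin (k + 1))) (r : Str n) (z : Fin L → Str n) (c : Fin n → Fin (k + 1)) :
    acc f D (checks Q r (fun j => (z j, f (z j))) c) = 1 - ind (RoundRejects f Q r z c) := by
  rw [checks, acc_andAll]
  by_cases h : RoundRejects f Q r z c
  · rw [ind_of h, sub_self]
    refine List.prod_eq_zero (List.mem_map.2 ?_)
    rcases h with ⟨a, ha, h⟩ | ⟨J, hJ, h⟩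
    · refine ⟨_, List.mem_append_left _ (List.mem_map_of_mem (Finset.mem_toList.2 ha)), ?_⟩
      rw [acc_query]
      change acc f D (halt (f (flipOn r _))) = 0
      rw [show f (flipOn r {e ∈ unionAll (posDiff r) (fun j => (z j, f (z j))) | c e = a}) = false
        from h]
      simp
    · refine ⟨_, List.mem_append_right _ ((List.mem_ofFn' _ _).2 ⟨J, rfl⟩), ?_⟩
      dsimp only
      rw [hJ, if_neg (by simp), acc_negCheck, ind_of, sub_self]
      exact h
  · rw [ind_of_not h, sub_zero]
    refine List.prod_eq_one fun v hv => ?_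
    obtain ⟨A, hA, rfl⟩ := List.mem_map.1 hv
    rcases List.mem_append.1 hA with hA | hA
    · obtain ⟨a, ha, rfl⟩ := List.mem_map.1 hA
      rw [acc_query]
      rw [show f (flipOn r {e ∈ unionAll (posDiff r) (fun j => (z j, f (z j))) | c e = a}) = true
        from by_contra fun hne => h (Or.inl ⟨a, Finset.mem_toList.1 ha, Bool.eq_false_iff.2 hne⟩)]
      simp
    · obtain ⟨J, rfl⟩ := (List.mem_ofFn' _ _).1 hA
      dsimp only
      split
      · simp
      · rename_i hJ
        rw [acc_negCheck, ind_of_not, sub_zero]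
        exact fun hc => h (Or.inr ⟨J, by simpa using hJ, hc⟩)

theorem acc_round [NeZero n] (f : BoolFun n) (D : PMF (Str n)) (L k : ℕ)
    (Q : Finset (Fin (k + 1))) : acc f D (round n L k Q) =
      ∑ r, (D r).toReal * if f r then prodExp (fun z => (D z).toReal) fun z : Fin L → Str n =>
        prodExp (fun _ : Fin (k + 1) => 1 / ((k : ℝ) + 1)) fun c : Fin n → Fin (k + 1) =>
          1 - ind (RoundRejects f Q r z c) else 1 := by
  rw [round, acc_sample]
  refine Finset.sum_congr rfl fun r _ => ?_
  congr 1
  split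
  · rw [acc_sampleMany]
    congr 1
    funext z
    rw [acc_tossMany]
    congr 1
    funext c
    exact acc_checks f D Q r z c
  · simp

theorem sum_uniform (k : ℕ) : ∑ _ : Fin (k + 1), 1 / ((k : ℝ) + 1) = 1 := by
  have : (k : ℝ) + 1 ≠ 0 := by positivity
  simp [this]

/-- Positive differences avoid the support `U` and witnesses belong to it, so no check can fail. -/
theorem not_roundRejects_of_mem_conj [NeZero n] {f : BoolFun n} (hf : f ∈ conj n) {L k : ℕ}
    (Q : Finset (Fin (k + 1))) {r : Str n} (hr : f r = true) (z : Fin L → Str n)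
    (c : Fin n → Fin (k + 1)) : ¬RoundRejects f Q r z c := by
  obtain ⟨U, hU⟩ := exists_support_of_mem_conj hf hr
  have hY : ∀ y, ∀ e ∈ posDiff r (y, f y), e ∉ U := by
    intro y e he heU
    unfold posDiff at he
    split at he
    · rename_i hy
      exact (Finset.mem_filter.1 he).2 ((hU y).1 hy e heU)
    · simp at he
  have hflip : ∀ A, f (flipOn r A) = true ↔ ∀ e ∈ U, e ∉ A := fun A => by
    simp only [hU, flipOn_eq_iff]
  rintro (⟨a, -, h⟩ | ⟨J, hJ, h | h⟩)
  · have : f (flipOn r {e ∈ unionAll (fun y => posDiff r (y, f y)) z | c e = a}) = true := by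
      rw [hflip]
      intro e heU he
      obtain ⟨j, -, hj⟩ := Finset.mem_biUnion.1 (Finset.mem_filter.1 he).1
      exact hY _ e hj heU
    exact absurd (this.symm.trans h) (by simp)
  · obtain ⟨j, -, hj⟩ := Finset.mem_biUnion.1 h
    exact hY _ _ hj ((witness_spec hr hJ).2 U hU)
  · exact (hflip _).1 h _ ((witness_spec hr hJ).2 U hU) (Finset.mem_insert_self _ _)

theorem acc_round_of_mem_conj [NeZero n] {f : BoolFun n} (hf : f ∈ conj n) (D : PMF (Str n))
    (L k : ℕ) (Q : Finset (Fin (k + 1))) : acc f D (round n L k Q) = 1 := by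
  rw [acc_round]
  refine Eq.trans ?_ (sum_toReal_pmf D)
  refine Finset.sum_congr rfl fun r _ => ?_
  split
  · rename_i hr
    have : ∀ (z : Fin L → Str n) (c : Fin n → Fin (k + 1)), ind (RoundRejects f Q r z c) = 0 :=
      fun z c => ind_of_not (not_roundRejects_of_mem_conj hf Q hr z c)
    simp only [this, sub_zero, prodExp_const (sum_uniform k), prodExp_const (sum_toReal_pmf D),
      mul_one]
  · rw [mul_one]

/-- Where `f` disagrees with "agree with `r` on `S`", a negative string agrees with `r` on `S`, so
its witness is outside `S`; a positive one differs from `r` somewhere in `S`. -/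
theorem far_support [NeZero n] {f : BoolFun n} {D : PMF (Str n)} {ε : ℝ}
    (hfar : IsFar ε D f (conj n)) {r : Str n} (hr : f r = true) (S : Finset (Fin n)) :
    ε ≤ ∑ y, (D y).toReal * ind (f y = false ∧ witness f r y ∉ S)
      + ∑ y, (D y).toReal * ind (∃ i ∈ posDiff r (y, f y), i ∈ S) := by
  refine (hfar.le_dist (agree_mem_conj r S)).trans ?_
  rw [dist_eq_sum_ind, ← Finset.sum_add_distrib]
  refine Finset.sum_le_sum fun y _ => ?_
  rw [← mul_add]
  refine mul_le_mul_of_nonneg_left ?_ ENNReal.toReal_nonneg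
  have h1 := ind_nonneg (f y = false ∧ witness f r y ∉ S)
  have h2 := ind_nonneg (∃ i ∈ posDiff r (y, f y), i ∈ S)
  cases hy : f y
  · rw [hy] at h1 h2
    refine (ind_mono fun h => ⟨rfl, fun hw => ?_⟩).trans (le_add_of_nonneg_right h2)
    have : ∀ e ∈ S, y e = r e := by simpa using h
    exact (witness_spec hr hy).1 (this _ hw)
  · rw [hy] at h1 h2
    refine (ind_mono fun h => ?_).trans (le_add_of_nonneg_left h1)
    have : ∃ e ∈ S, y e ≠ r e := by simpa using h
    obtain ⟨e, he, hne⟩ := this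
    exact ⟨e, by simpa [posDiff, diffSet] using hne, he⟩

theorem acc_round_of_far [NeZero n] {f : BoolFun n} {D : PMF (Str n)} {ε : ℝ}
    (hfar : IsFar ε D f (conj n)) (hε0 : 0 < ε) (hε1 : ε ≤ 1) {L k : ℕ}
    (Q : Finset (Fin (k + 1))) (hL : 0 < L) (hm : 20 * (n * (1 / ((k : ℝ) + 1))) ≤ L * ε)
    (hx : L * (1 / ((k : ℝ) + 1) * Q.card) ≤ 2 / 5)
    (hx' : ε / 21 ≤ L * (1 / ((k : ℝ) + 1) * Q.card)) :
    acc f D (round n L k Q) ≤ 1 - ε ^ 3 / 200 := by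
  have hD : ∀ z, 0 ≤ (D z).toReal := fun _ => ENNReal.toReal_nonneg
  -- The constant `false` is a conjunction, so `f` is true with probability at least `ε`.
  have hpos : ε ≤ ∑ r, (D r).toReal * ind (f r = true) := by
    have := hfar.le_dist const_false_mem_conj
    rw [dist_eq_sum_ind] at this
    simpa using this
  have hacc : acc f D (round n L k Q) ≤
      ∑ r, ((D r).toReal - ε ^ 2 / 200 * ((D r).toReal * ind (f r = true))) := by
    rw [acc_round]
    refine Finset.sum_le_sum fun r _ => ?_
    split
    · rename_i hr
      have h := rejects_lower hD (sum_toReal_pmf D) (sum_uniform k) (by positivity) f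
        (fun y => posDiff r (y, f y)) (witness f r) (fun A => f (flipOn r A)) Q 0 hε0 hε1
        (far_support hfar hr) hL (by simpa using hm) hx hx'
      simp only [prodExp_sub, prodExp_const (sum_uniform k), prodExp_const (sum_toReal_pmf D)]
      have h' := mul_le_mul_of_nonneg_left h (hD r)
      rw [ind_of hr]
      change _ ≤ (D r).toReal * (prodExp _ fun z => prodExp _ fun c =>
        ind (RoundRejects f Q r z c)) at h'
      linarith
    · rename_i hr
      rw [ind_of_not hr]
      simp
  rw [Finset.sum_sub_distrib, sum_toReal_pmf, ← Finset.mul_sum] at hacc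
  nlinarith [sq_nonneg ε]

end OracleAlg


/-! ### Choice of parameters and soundness of the repeated test -/

/-- The number of samples in a round. -/
noncomputable def numSamples (n : ℕ) : ℕ := ⌈(n : ℝ) ^ (1 / 3 : ℝ)⌉₊

/-- One less than the number of colours in a round. -/
noncomputable def colourBound (n : ℕ) (ε : ℝ) : ℕ := ⌈20 * n / (numSamples n * ε)⌉₊ - 1

/-- The colours tested in a round. -/
def testedColours (L k : ℕ) : Finset (Fin (k + 1)) := {a | a.val < L}

/-- The number of rounds. -/
noncomputable def numRounds (ε : ℝ) : ℕ := ⌈400 / ε ^ 3⌉₊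

/-- The tester: independent rounds, all of which have to accept. -/
noncomputable def tester (n : ℕ) [NeZero n] (ε : ℝ) : OracleAlg n :=
  OracleAlg.andAll (List.replicate (numRounds ε)
    (OracleAlg.round n (numSamples n) (colourBound n ε)
      (testedColours (numSamples n) (colourBound n ε))))

section Parameters

variable {n : ℕ} {ε : ℝ}

theorem cbrt_pow_three (n : ℕ) : ((n : ℝ) ^ (1 / 3 : ℝ)) ^ 3 = n := by
  rw [← Real.rpow_natCast, ← Real.rpow_mul (Nat.cast_nonneg n)]
  norm_num

theorem one_le_cbrt (hn : 1 ≤ n) : 1 ≤ (n : ℝ) ^ (1 / 3 : ℝ) :=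
  Real.one_le_rpow (by exact_mod_cast hn) (by norm_num)

theorem numSamples_le (hn : 1 ≤ n) : (numSamples n : ℝ) ≤ 2 * (n : ℝ) ^ (1 / 3 : ℝ) := by
  have h1 := one_le_cbrt hn
  have h2 := (Nat.ceil_lt_add_one (zero_le_one.trans h1)).le
  unfold numSamples
  linarith

theorem le_numSamples_pow (n : ℕ) : (n : ℝ) ≤ (numSamples n : ℝ) ^ 3 := by
  conv_lhs => rw [← cbrt_pow_three n]
  exact pow_le_pow_left₀ (by positivity) (Nat.le_ceil _) 3

theorem numSamples_pow_le (hn : 1 ≤ n) : (numSamples n : ℝ) ^ 3 ≤ 8 * n := by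
  have := pow_le_pow_left₀ (Nat.cast_nonneg _) (numSamples_le hn) 3
  rw [mul_pow, cbrt_pow_three] at this
  linarith

theorem numSamples_pos (hn : 1 ≤ n) : 0 < numSamples n :=
  Nat.ceil_pos.2 (zero_lt_one.trans_le (one_le_cbrt hn))

theorem numSamples_le_self (hn : 1 ≤ n) : numSamples n ≤ n := by
  refine Nat.ceil_le.2 ?_
  have h1 : (1 : ℝ) ≤ n := by exact_mod_cast hn
  calc (n : ℝ) ^ (1 / 3 : ℝ) ≤ (n : ℝ) ^ (1 : ℝ) :=
        Real.rpow_le_rpow_of_exponent_le h1 (by norm_num)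
    _ = n := Real.rpow_one _

theorem colourBound_add_one (hn : 1 ≤ n) (hε0 : 0 < ε) :
    (colourBound n ε : ℝ) + 1 = ⌈20 * n / (numSamples n * ε)⌉₊ := by
  have hL : (0 : ℝ) < numSamples n := by exact_mod_cast numSamples_pos hn
  have hn' : (0 : ℝ) < n := by exact_mod_cast hn
  have : 0 < ⌈20 * n / (numSamples n * ε)⌉₊ := Nat.ceil_pos.2 (by positivity)
  unfold colourBound
  rw [← Nat.cast_add_one, Nat.sub_add_cancel this]

theorem le_colourBound (hn : 1 ≤ n) (hε0 : 0 < ε) : 20 * n ≤ numSamples n * ε * ((colourBound n ε : ℝ) + 1) := by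
  have hL : (0 : ℝ) < numSamples n := by exact_mod_cast numSamples_pos hn
  rw [colourBound_add_one hn hε0, ← div_le_iff₀' (by positivity)]
  exact Nat.le_ceil _

/-- Rounding up adds at most `numSamples n * ε ≤ n`, which turns 20 into 21. -/
theorem colourBound_le (hn : 1 ≤ n) (hε0 : 0 < ε) (hε1 : ε ≤ 1) : numSamples n * ε * ((colourBound n ε : ℝ) + 1) ≤ 21 * n := by
  have hL : (0 : ℝ) < numSamples n := by exact_mod_cast numSamples_pos hn
  have hLn : (numSamples n : ℝ) ≤ n := by exact_mod_cast numSamples_le_self hn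
  rw [colourBound_add_one hn hε0]
  have h := (Nat.ceil_lt_add_one (a := 20 * n / (numSamples n * ε)) (by positivity)).le
  have h2 := mul_le_mul_of_nonneg_left h (by positivity : 0 ≤ numSamples n * ε)
  rw [mul_add, mul_div_cancel₀ _ (by positivity)] at h2
  nlinarith

/-- There are enough colours for as many to be tested as there are samples. -/
theorem numSamples_le_colourBound (hn : 1 ≤ n) (hε0 : 0 < ε) (hε1 : ε ≤ 1) : numSamples n ≤ colourBound n ε + 1 := by
  have hL : (0 : ℝ) < numSamples n := by exact_mod_cast numSamples_pos hn
  have h1 := le_colourBound hn hε0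
  have h2 := numSamples_pow_le hn
  have h3 : (numSamples n : ℝ) * ε * ((colourBound n ε : ℝ) + 1) ≤
      numSamples n * ((colourBound n ε : ℝ) + 1) := by
    refine mul_le_mul_of_nonneg_right ?_ (by positivity)
    nlinarith
  have h4 : (1 : ℝ) ≤ numSamples n := by exact_mod_cast numSamples_pos hn
  have h5 : (numSamples n : ℝ) * numSamples n ≤ numSamples n * ((colourBound n ε : ℝ) + 1) := by
    nlinarith [mul_pos hL hL]
  exact_mod_cast le_of_mul_le_mul_left h5 hL

theorem card_testedColours (hn : 1 ≤ n) (hε0 : 0 < ε) (hε1 : ε ≤ 1) :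
    (testedColours (numSamples n) (colourBound n ε)).card = numSamples n := by
  have h := numSamples_le_colourBound hn hε0 hε1
  rw [testedColours, Fin.card_filter_val_lt]
  exact min_eq_right h

theorem acc_tester_of_far [NeZero n] (hn : 1 ≤ n) (hε0 : 0 < ε) (hε1 : ε ≤ 1)
    {f : BoolFun n} {D : PMF (Str n)}
    (hfar : IsFar ε D f (conj n)) : (tester n ε).acc f D ≤ 1 / 3 := by
  have hL : (0 : ℝ) < numSamples n := by exact_mod_cast numSamples_pos hn
  have hk : (0 : ℝ) < (colourBound n ε : ℝ) + 1 := by positivity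
  have hn' : (0 : ℝ) < n := by exact_mod_cast hn
  have h1 := le_colourBound hn hε0
  have h2 := colourBound_le hn hε0 hε1
  have h := OracleAlg.acc_round_of_far hfar hε0 hε1
    (testedColours (numSamples n) (colourBound n ε)) (numSamples_pos hn)
    (by
      rw [mul_one_div, ← mul_div_assoc, div_le_iff₀ hk]
      exact h1)
    (by
      rw [card_testedColours hn hε0 hε1, one_div_mul_eq_div, ← mul_div_assoc, div_le_iff₀ hk]
      -- With `L` samples, `L ^ 3 ≤ 8 * n` and at least `20 * n / (L * ε)` colours give `8 / 20 = 2
      -- / 5`.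
      have h3 := numSamples_pow_le hn
      refine le_of_mul_le_mul_left ?_ hL
      nlinarith [mul_pos hL hk])
    (by
      rw [card_testedColours hn hε0 hε1, one_div_mul_eq_div, ← mul_div_assoc, le_div_iff₀ hk]
      have h3 := le_numSamples_pow n
      refine le_of_mul_le_mul_left ?_ hL
      nlinarith)
  rw [tester, OracleAlg.acc_andAll, List.map_replicate, List.prod_replicate]
  have hε3 : 0 < ε ^ 3 := by positivity
  have h0 : 0 ≤ 1 - ε ^ 3 / 200 := (OracleAlg.acc_nonneg f D _).trans h
  have hR : 400 / ε ^ 3 ≤ numRounds ε := Nat.le_ceil _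
  rw [div_le_iff₀ hε3] at hR
  calc _ ≤ (1 - ε ^ 3 / 200) ^ numRounds ε :=
        pow_le_pow_left₀ (OracleAlg.acc_nonneg f D _) h _
    _ ≤ (Real.exp (-(ε ^ 3 / 200))) ^ numRounds ε :=
        pow_le_pow_left₀ h0 (Real.one_sub_le_exp_neg _) _
    _ = Real.exp (numRounds ε * -(ε ^ 3 / 200)) := (Real.exp_nat_mul _ _).symm
    -- The exponent is at least `400 / 200 = 2`, and `exp 2 ≥ 3`.
    _ ≤ Real.exp (-2) := Real.exp_le_exp.2 (by linarith)
    _ ≤ 1 / 3 := by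
        rw [Real.exp_neg, ← one_div]
        exact one_div_le_one_div_of_le (by norm_num) (by linarith [Real.add_one_le_exp (2 : ℝ)])

theorem numRounds_le (hε0 : 0 < ε) (hε1 : ε ≤ 1) : (numRounds ε : ℝ) ≤ 401 / ε ^ 3 := by
  have h := (Nat.ceil_lt_add_one (a := 400 / ε ^ 3) (by positivity)).le
  have h1 : 1 ≤ 1 / ε ^ 3 := one_le_one_div (by positivity) (pow_le_one₀ hε0.le hε1)
  unfold numRounds
  calc _ ≤ 400 / ε ^ 3 + 1 := h
    _ ≤ 400 / ε ^ 3 + 1 / ε ^ 3 := by linarith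
    _ = 401 / ε ^ 3 := by ring

end Parameters

/-! ### Query count -/

theorem natLog_add_three_le {n : ℕ} (hn : 2 ≤ n) {ε : ℝ} (hε0 : 0 < ε) (hε1 : ε ≤ 1) :
    3 * (Nat.log 2 n : ℝ) + 6 ≤ 160 * Real.log (n / ε) ^ 7 := by
  have hn' : (2 : ℝ) ≤ n := by exact_mod_cast hn
  have hlog2 := Real.log_two_gt_d9
  have h1 : (Nat.log 2 n : ℝ) * Real.log 2 ≤ Real.log n := by
    rw [← Real.log_pow]
    refine Real.log_le_log (by positivity) ?_
    exact_mod_cast Nat.pow_log_le_self 2 (by omega)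
  have h2 : Real.log n ≤ Real.log (n / ε) := by
    refine Real.log_le_log (by linarith) ?_
    rw [le_div_iff₀ hε0]
    nlinarith
  have h3 : Real.log 2 ≤ Real.log n := Real.log_le_log (by norm_num) hn'
  set x := Real.log (n / ε) with hx
  have hx1 : 69 / 100 ≤ x := by linarith
  have h4 : (Nat.log 2 n : ℝ) * (69 / 100) ≤ x :=
    (mul_le_mul_of_nonneg_left (by linarith) (Nat.cast_nonneg _)).trans (h1.trans h2)
  -- Since `n ≥ 2`, the logarithm is at least `log 2 > 0.69`, and `0.69 ^ 6 > 1 / 10`; so the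
  -- seventh power dominates a linear term.
  have h5 : (69 / 100 : ℝ) ^ 6 ≤ x ^ 6 := pow_le_pow_left₀ (by norm_num) hx1 6
  have h6 : 1 / 10 * x ≤ x ^ 6 * x := mul_le_mul_of_nonneg_right (by norm_num at h5 ⊢; linarith)
    (by linarith)
  have h7 : x ^ 7 = x ^ 6 * x := by ring
  rw [h7]
  linarith

theorem numQueries_tester_le {n : ℕ} [NeZero n] (hn : 2 ≤ n) {ε : ℝ} (hε0 : 0 < ε) (hε1 : ε ≤ 1) :
    ((tester n ε).numQueries : ℝ) ≤
      200000 * (((n : ℝ) ^ (1 / 3 : ℝ) / ε ^ 5) * Real.log ((n : ℝ) / ε) ^ 7) := by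
  have hn1 : 1 ≤ n := by omega
  have h1 : (tester n ε).numQueries ≤
      numRounds ε * (numSamples n * (2 * Nat.log 2 n + 6)) := by
    refine (OracleAlg.numQueries_andAll_le
      (N := numSamples n * (2 * Nat.log 2 n + 6)) ?_).trans (by rw [List.length_replicate])
    intro A hA
    rw [List.eq_of_mem_replicate hA]
    refine (OracleAlg.numQueries_round_le _ _ _).trans ?_
    rw [card_testedColours hn1 hε0 hε1]
    have := numSamples_pos hn1
    nlinarith
  have h2 : (2 * Nat.log 2 n + 6 : ℝ) ≤ 160 * Real.log (n / ε) ^ 7 := by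
    have := natLog_add_three_le hn hε0 hε1
    have : (0 : ℝ) ≤ Nat.log 2 n := Nat.cast_nonneg _
    linarith
  have hpow : 401 / ε ^ 3 ≤ 401 / ε ^ 5 :=
    div_le_div_of_nonneg_left (by norm_num) (by positivity)
      (pow_le_pow_of_le_one hε0.le hε1 (by norm_num))
  have hlog : (0 : ℝ) ≤ 160 * Real.log (n / ε) ^ 7 := le_trans (by positivity) h2
  calc ((tester n ε).numQueries : ℝ)
      ≤ numRounds ε * (numSamples n * (2 * Nat.log 2 n + 6)) := by exact_mod_cast h1
    _ ≤ (401 / ε ^ 5) * ((2 * (n : ℝ) ^ (1 / 3 : ℝ)) * (160 * Real.log (n / ε) ^ 7)) :=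
        mul_le_mul ((numRounds_le hε0 hε1).trans hpow)
          (mul_le_mul (numSamples_le hn1) h2 (by positivity) (by positivity))
          (by positivity) (by positivity)
    _ = 128320 * (((n : ℝ) ^ (1 / 3 : ℝ) / ε ^ 5) * Real.log ((n : ℝ) / ε) ^ 7) := by ring
    _ ≤ _ := mul_le_mul_of_nonneg_right (by norm_num)
        (mul_nonneg (by positivity) (by linarith))

theorem acc_tester_of_mem_conj {n : ℕ} [NeZero n] (ε : ℝ) {f : BoolFun n} (hf : f ∈ conj n)
    (D : PMF (Str n)) : (tester n ε).acc f D = 1 := by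
  rw [tester, OracleAlg.acc_andAll, List.map_replicate, List.prod_replicate,
    OracleAlg.acc_round_of_mem_conj hf, one_pow]

/-- Dimension one is treated apart because the query bound vanishes at `ε = 1`, where `log (n / ε) =
0`. -/
theorem mem_conj_one (f : BoolFun 1) : f ∈ conj 1 := by
  have hz : ∀ z : Str 1, z = fun _ => z 0 := fun z => funext fun i => by rw [Fin.eq_zero i]
  refine ⟨if f (fun _ => false) then ∅ else {0}, if f (fun _ => true) then ∅ else {0},
    fun z => ?_⟩
  rw [hz z]
  cases z 0 <;> cases h0 : f (fun _ => false) <;> cases h1 : f (fun _ => true) <;> simp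

theorem not_isFar_of_mem {n : ℕ} {C : Set (BoolFun n)} {ε : ℝ} (hε : 0 < ε) {f : BoolFun n}
    (hf : f ∈ C) (D : PMF (Str n)) : ¬IsFar ε D f C := by
  intro h
  have h1 := h.le_dist hf
  have h2 : dist D f f = 0 := by simp [dist]
  linarith

/-- The tester for all dimensions; in dimension at most one there is nothing to test. -/
noncomputable def conjTester : (n : ℕ) → ℝ → OracleAlg n
  | 0, _ => .halt true
  | 1, _ => .halt true
  | n + 2, ε => tester (n + 2) (min ε 1)

end DistFree

theorem theorem3 :
    ∃ (K : ℝ) (T : ∀ n : ℕ, ℝ → DistFree.OracleAlg n), ∀ n : ℕ, 1 ≤ n →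
      DistFree.IsTester (DistFree.conj n) (T n) ∧
      DistFree.IsOneSided (DistFree.conj n) (T n) ∧
      ∀ ε : ℝ, 0 < ε → ε ≤ 1 →
        ((T n ε).numQueries : ℝ) ≤
          K * (((n : ℝ) ^ (1 / 3 : ℝ) / ε ^ 5) * Real.log ((n : ℝ) / ε) ^ 7) := by
  open DistFree in
  refine ⟨200000, conjTester, fun n hn => ?_⟩
  obtain _ | _ | n := n
  · omega
  · refine ⟨fun ε hε f D => ⟨fun _ => ?_, fun h => ?_⟩, fun ε _ f D _ => ?_, fun ε hε hε1 => ?_⟩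
    · change 2 / 3 ≤ (OracleAlg.halt true).acc f D
      rw [OracleAlg.acc_halt]
      norm_num
    · exact absurd h (not_isFar_of_mem hε (mem_conj_one f) D)
    · simp [conjTester, OracleAlg.run]
    · have : 0 ≤ Real.log (((0 + 1 : ℕ) : ℝ) / ε) :=
        Real.log_nonneg ((one_le_div hε).2 (by simpa using hε1))
      simp only [conjTester, OracleAlg.numQueries, Nat.cast_zero]
      positivity
  · have hmin : ∀ {ε : ℝ}, 0 < ε → 0 < min ε 1 := fun h => lt_min h one_pos
    have hacc : ∀ {ε : ℝ} {f : BoolFun (n + 2)} {D : PMF (Str (n + 2))}, f ∈ conj (n + 2) →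
        (conjTester (n + 2) ε).acc f D = 1 := fun hf => acc_tester_of_mem_conj _ hf _
    refine ⟨fun ε hε f D => ⟨fun hf => ?_, fun hfar => ?_⟩, fun ε hε f D hf => ?_,
      fun ε hε hε1 => ?_⟩
    · change 2 / 3 ≤ (conjTester (n + 2) ε).acc f D
      rw [hacc hf]
      norm_num
    · rw [OracleAlg.run_false_toReal]
      -- Lowering the distance parameter to at most 1 preserves farness and covers `ε > 1`.
      have := acc_tester_of_far hn (hmin hε) (min_le_right ε 1)
        (le_trans (min_le_left ε 1) hfar : IsFar (min ε 1) D f (conj (n + 2)))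
      change 2 / 3 ≤ 1 - (tester (n + 2) (min ε 1)).acc f D
      linarith
    · have h := hacc (ε := ε) (D := D) hf
      exact (ENNReal.toReal_eq_one_iff _).1 h
    · change ((tester (n + 2) (min ε 1)).numQueries : ℝ) ≤ _
      rw [min_eq_left hε1]
      exact numQueries_tester_le (by omega) hε hε1
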